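/- Let $m$ be an even positive integer and let $B_1, B_2 : \mathbb{F}_{2^m}\to\mathbb{F}_2$ be two different Boolean bent functions, that is, $W_{B_i}(b)=\sum_{x\in\mathbb{F}_{2^m}}(-1)^{B_i(x)+\mathrm{Tr}(bx)}=\pm 2^{m/2}$ for every $b\in\mathbb{F}_{2^m}$, where $\mathrm{Tr}$ is the trace from $\mathbb{F}_{2^m}$ to $\mathbb{F}_2$. Put $W=W_{B_1}(0)\,W_{B_2}(0)$ and $\mathcal{D}=\{(x,y)\in\mathbb{F}_{2^m}^2 : B_1(x)+B_2(y)=0\}$. Let $\mathcal{C}^{(2)}$ be the binary subfield code of the code over $\mathbb{F}_{2^m}$ generated by the matrix whose columns are $(0,1,0)^{T}$ followed by $(1,x,y)^{T}$ for all $(x,y)\in\mathcal{D}$; that is, each entry of this matrix is replaced by its column of coordinates with respect to a basis of $\mathbb{F}_{2^m}$ over $\mathbb{F}_2$, and $\mathcal{C}^{(2)}$ is the binary code spanned by the rows of the resulting matrix. Let $\bar{\mathcal{C}}^{(2)}$ be $\mathcal{C}^{(2)}$ punctured on the first coordinate; equivalently, $$\bar{\mathcal{C}}^{(2)}=\left\{\left(a+\mathrm{Tr}(bx+cy)\right)_{(x,y)\in\mathcal{D}}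 : a\in\mathbb{F}_2,\ b,c\in\mathbb{F}_{2^m}\right\}.$$ Say that the codewords of weight $\kappa$ of a binary code hold a $2$-design if there are such codewords and there is a positive integer $\lambda$ such that every pair of coordinates is contained in exactly $\lambda$ of the supports of the codewords of weight $\kappa$ (where $2\le\kappa\le n$ and $n$ is the length of the code). Then the following hold. (0) $W=\pm 2^m$. (1) The codewords of weight $2^{2m-2}+\frac{W}{4}-2^{m-2}$ in $\bar{\mathcal{C}}^{(2)}$ hold a $2$-design, and so do the codewords of weight $2^{2m-2}+\frac{W}{4}+2^{m-2}$. (2) For every $\kappa$ with $4\le\kappa\le 2^{2m-1}+\frac{W}{2}$ for which the dual code $\bar{\mathcal{C}}^{(2)\perp}$ has a codeword of weight $\kappa$, the codewords of weight $\kappa$ in $\bar{\mathcal{C}}^{(2)\perp}$ hold a $2$-design. -/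

import Mathlib

noncomputable section

namespace BentDesign

/-! ### Bent functions -/

/-- The Walsh transform `W_B(b) = ∑_x (-1)^(B(x) + Tr(b x))` of a Boolean function on a finite
field of characteristic two. -/
def walsh {K : Type*} [Field K] [Fintype K] [Algebra (ZMod 2) K] (B : K → ZMod 2) (b : K) : ℤ :=
  ∑ x : K, (-1 : ℤ) ^ (B x + Algebra.trace (ZMod 2) K (b * x)).val

/-- `B` is a Boolean bent function on the field with `2 ^ m` elements:
`W_B(b) = ± 2 ^ (m / 2)` for every `b` (a real power). -/
def IsBent {K : Type*} [Field K] [Fintype K] [Algebra (ZMod 2) K] (m : ℕ) (B : K → ZMod 2) :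
    Prop :=
  ∀ b : K, (walsh B b : ℝ) = (2 : ℝ) ^ ((m : ℝ) / 2) ∨ (walsh B b : ℝ) = -(2 : ℝ) ^ ((m : ℝ) / 2)

/-! ### Linear codes -/

/-- The subfield code over `F` of the code over `K` with generator matrix `G`: every entry of `G`
is replaced by its column of coordinates with respect to the basis `β` of `K` over `F`, and the
rows of the resulting matrix span the code. -/
def subfieldCode {F K ι ρ n : Type*} [Field F] [Field K] [Algebra F K] (β : Module.Basis ι F K)
    (G : Matrix ρ n K) : Submodule F (n → F) :=
  Submodule.span F (Set.range fun r : ρ × ι => fun j : n => β.repr (G r.1 j) r.2)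

/-- Puncturing a code at the coordinate `none`. -/
def puncture {F n : Type*} [Field F] (C : Submodule F (Option n → F)) : Submodule F (n → F) :=
  C.map (LinearMap.funLeft F F (some : n → Option n))

/-- The dual code with respect to the standard inner product. -/
def dualCode {F n : Type*} [Field F] [Fintype n] (C : Submodule F (n → F)) :
    Submodule F (n → F) where
  carrier := {x | ∀ c ∈ C, x ⬝ᵥ c = 0}
  add_mem' := by
    intro x y hx hy c hc
    rw [add_dotProduct, hx c hc, hy c hc, add_zero]
  zero_mem' := by
    intro c _
    exact zero_dotProduct c
  smul_mem' := by
    intro a x hx c hc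
    rw [smul_dotProduct, hx c hc, smul_zero]

/-- The set `{(x, y) : f(x) + g(y) = 0}`. -/
abbrev ZeroSet {F K : Type*} [Field F] (f g : K → F) : Type _ :=
  {p : K × K // f p.1 + g p.2 = 0}

/-- The matrix over `K` with first column `(0, 1, 0)` (indexed by `none`), followed by the
columns `(1, x, y)` for all `(x, y)` with `f(x) + g(y) = 0`. -/
def genMatrix {F K : Type*} [Field F] [Field K] (f g : K → F) :
    Matrix (Fin 3) (Option (ZeroSet f g)) K :=
  fun i j =>
    match j with
    | none => ![0, 1, 0] i
    | some p => ![1, p.1.1, p.1.2] i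

/-- The subfield code over `F` of the code over `K` generated by `genMatrix f g`, punctured on the
first coordinate. -/
def puncturedSubfieldCode {F K ι : Type*} [Field F] [Field K] [Algebra F K]
    (β : Module.Basis ι F K) (f g : K → F) : Submodule F (ZeroSet f g → F) :=
  puncture (subfieldCode β (genMatrix f g))

/-! ### Designs held by codes -/

/-- `(P, 𝓑)` is a (simple) `t`-`(v, k, lam)` design, where `v` is the cardinality of `P`. -/
structure IsDesign {P : Type*} [Fintype P] (𝓑 : Set (Finset P)) (t k lam : ℕ) : Prop where
  one_le_t : 1 ≤ t
  t_le : t ≤ k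
  k_le : k ≤ Fintype.card P
  block_card : ∀ b ∈ 𝓑, b.card = k
  balanced : ∀ T : Finset P, T.card = t → {b ∈ 𝓑 | T ⊆ b}.ncard = lam

/-- The support of a word. -/
def suppt {F n : Type*} [Field F] [DecidableEq F] [Fintype n] (c : n → F) : Finset n :=
  Finset.univ.filter fun i => c i ≠ 0

/-- The set of the supports of all codewords of Hamming weight `k` in `C`. -/
def blocks {F n : Type*} [Field F] [DecidableEq F] [Fintype n] (C : Submodule F (n → F)) (k : ℕ) :
    Set (Finset n) :=
  {s | ∃ c ∈ C, hammingNorm c = k ∧ suppt c = s}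

/-- The codewords of weight `k` in `C` hold a `t`-design: there are such codewords, and their
supports are the blocks of a `t`-`(n, k, lam)` design for a positive integer `lam`. -/
def HoldsDesign {F n : Type*} [Field F] [DecidableEq F] [Fintype n] (C : Submodule F (n → F))
    (t k : ℕ) : Prop :=
  (∃ c ∈ C, hammingNorm c = k) ∧ ∃ lam : ℕ, 0 < lam ∧ IsDesign (blocks C k) t k lam

end BentDesign

end

namespace BentDesign

/-! ### Two-weight binary codes: words with prescribed values at two coordinates. -/

section Code

variable {n : Type*} [Fintype n]

/-! The punctured code `C` consists of the restrictions to `D = ZeroSet B₁ B₂` of the affine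
functions on `K × K` over the prime field. Writing the indicator of `D` as `(1 + (-1)^(B₁ x + B₂ y))
/ 2` turns a character sum over `D` into a product of two linear character sums plus a product of
two Walsh values (`two_mul_sum_sign_affineRestrict`). For a nonzero linear part the first product
vanishes and bentness makes the second `± 2 ^ m`. So, apart from `0` and `1`, only two weights
occur, `(n ± 2 ^ (m - 1)) / 2` with `n = |D|`.

Three distinct points over the field with two elements are affinely independent, so `C` takes all
values equally often on any three coordinates. Hence the number and the total weight of the words
with given values at `i ≠ j` do not depend on `i, j`; two moments determine two unknown weight
counts (`pairCount_eq_pairCount`). For the dual, orthogonality of characters expresses the count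
through the joint distribution of `(hammingNorm c, c i, c j)` on `C`, which is the same for all
pairs (`pairCount_dualCode_eq`). -/

open scoped Classical in
/-- The number of codewords of weight `w` with the values `a`, `b` at the coordinates `i`, `j`. -/
noncomputable def pairCount (C : Submodule (ZMod 2) (n → ZMod 2)) (w : ℕ) (a b : ZMod 2)
    (i j : n) : ℕ :=
  (Finset.univ.filter fun c : n → ZMod 2 => c ∈ C ∧ hammingNorm c = w ∧ c i = a ∧ c j = b).card

theorem zmod_two_cases (a : ZMod 2) : a = 0 ∨ a = 1 := by
  revert a; decide

theorem suppt_injective : Function.Injective (suppt : (n → ZMod 2) → Finset n) := by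
  intro c d h
  funext i
  have hi : c i ≠ 0 ↔ d i ≠ 0 := by
    have := Finset.ext_iff.1 h i
    simpa [suppt] using this
  rcases zmod_two_cases (c i) with h1 | h1 <;> rcases zmod_two_cases (d i) with h2 | h2 <;>
    simp_all

open scoped Classical in
theorem ncard_blocks_pair (C : Submodule (ZMod 2) (n → ZMod 2)) (k : ℕ)
    (i j : n) : {b ∈ blocks C k | {i, j} ⊆ b}.ncard = pairCount C k 1 1 i j := by
  have h : {b ∈ blocks C k | {i, j} ⊆ b} = suppt '' (↑(Finset.univ.filter fun c : n → ZMod 2 =>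
      c ∈ C ∧ hammingNorm c = k ∧ c i = 1 ∧ c j = 1) : Set (n → ZMod 2)) := by
    have hne : ∀ a : ZMod 2, a ≠ 0 ↔ a = 1 := by decide
    ext b
    constructor
    · rintro ⟨⟨c, hc, hk, rfl⟩, hT⟩
      refine ⟨c, ?_, rfl⟩
      have h1 : i ∈ suppt c := hT (by simp)
      have h2 : j ∈ suppt c := hT (by simp)
      simp only [suppt, Finset.mem_filter, Finset.mem_univ, true_and, hne] at h1 h2
      simp [hc, hk, h1, h2]
    · rintro ⟨c, hc, rfl⟩
      simp only [Finset.coe_filter, Finset.mem_univ, true_and, Set.mem_ofPred_eq] at hc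
      refine ⟨⟨c, hc.1, hc.2.1, rfl⟩, ?_⟩
      intro l hl
      rcases Finset.mem_insert.1 hl with rfl | hl
      · simp [suppt, hc.2.2.1]
      · rw [Finset.mem_singleton.1 hl]
        simp [suppt, hc.2.2.2]
  rw [h, Set.ncard_image_of_injective _ suppt_injective, Set.ncard_coe_finset, pairCount]

theorem holdsDesign_two_of_pairCount (C : Submodule (ZMod 2) (n → ZMod 2)) (k : ℕ) (hk : 2 ≤ k)
    (hex : ∃ c ∈ C, hammingNorm c = k)
    (h : ∀ i j i' j' : n, i ≠ j → i' ≠ j' → pairCount C k 1 1 i j = pairCount C k 1 1 i' j') :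
    HoldsDesign C 2 k := by
  classical
  refine ⟨hex, ?_⟩
  obtain ⟨c, hc, hck⟩ := hex
  have hcard : (suppt c).card = k := hck
  obtain ⟨i, hi, j, hj, hij⟩ := Finset.one_lt_card.1 (show 1 < (suppt c).card by omega)
  have hne : ∀ a : ZMod 2, a ≠ 0 ↔ a = 1 := by decide
  simp only [suppt, Finset.mem_filter, Finset.mem_univ, true_and, hne] at hi hj
  refine ⟨pairCount C k 1 1 i j, ?_, by norm_num, hk, ?_, ?_, ?_⟩
  · exact Finset.card_pos.2 ⟨c, by simp [hc, hck, hi, hj]⟩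
  · rw [← hcard]; exact Finset.card_le_univ _
  · rintro b ⟨d, -, hd, rfl⟩
    exact hd
  · intro T hT
    obtain ⟨i', j', hne', rfl⟩ := Finset.card_eq_two.1 hT
    rw [← h i' j' i j hne' hij, ← ncard_blocks_pair]

-- Translation by `d` preserves `C` and `P` and exchanges the two values at `l`.
open scoped Classical in
theorem two_mul_card_filter_coord (C : Submodule (ZMod 2) (n → ZMod 2))
    (P : (n → ZMod 2) → Prop) [DecidablePred P] {d : n → ZMod 2} (hd : d ∈ C) (hP : ∀ c, P (c + d) ↔ P c) {l : n}
    (hl : d l = 1) (e : ZMod 2) :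
    2 * (Finset.univ.filter fun c : n → ZMod 2 => c ∈ C ∧ P c ∧ c l = e).card =
      (Finset.univ.filter fun c : n → ZMod 2 => c ∈ C ∧ P c).card := by
  have h1 : (Finset.univ.filter fun c : n → ZMod 2 => c ∈ C ∧ P c ∧ c l = e).card =
      (Finset.univ.filter fun c : n → ZMod 2 => c ∈ C ∧ P c ∧ ¬ c l = e).card := by
    refine Finset.card_equiv (Equiv.addRight d) fun c => ?_
    have hx : ∀ x y : ZMod 2, x = y ↔ ¬ x + 1 = y := by decide
    simp [Submodule.add_mem_iff_left C hd, hP, hl, hx (c l) e]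
  have h2 := Finset.card_filter_add_card_filter_not
    (s := Finset.univ.filter fun c : n → ZMod 2 => c ∈ C ∧ P c) (fun c => c l = e)
  simp only [Finset.filter_filter, and_assoc] at h2
  omega

/-- Any two coordinates can be separated from a third one by a codeword, so that no nonzero word
of weight at most three is orthogonal to a code with this property containing the word `1`. -/
def Separates (C : Submodule (ZMod 2) (n → ZMod 2)) : Prop :=
  ∀ i j l : n, l ≠ i → l ≠ j → ∃ d ∈ C, d i = 0 ∧ d j = 0 ∧ d l = 1

open scoped Classical in
theorem four_mul_card_filter_pair {C : Submodule (ZMod 2) (n → ZMod 2)} (h1 : (1 : n → ZMod 2) ∈ C)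
    (hC : Separates C) {i j : n} (hij : i ≠ j) (a b : ZMod 2) :
    4 * (Finset.univ.filter fun c : n → ZMod 2 => c ∈ C ∧ c i = a ∧ c j = b).card =
      (Finset.univ.filter fun c : n → ZMod 2 => c ∈ C).card := by
  -- Using `i` twice gives separation of two points.
  obtain ⟨d, hd, hdi, -, hdj⟩ := hC i i j hij.symm hij.symm
  have e1 := two_mul_card_filter_coord C (fun c => c i = a) hd (by simp [hdi]) hdj b
  have e2 := two_mul_card_filter_coord C (fun _ => True) h1 (by simp) (l := i) (by simp) a
  simp only [true_and, and_true] at e2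
  omega

open scoped Classical in
theorem eight_mul_card_filter_triple {C : Submodule (ZMod 2) (n → ZMod 2)}
    (h1 : (1 : n → ZMod 2) ∈ C) (hC : Separates C) {i j l : n} (hij : i ≠ j) (hli : l ≠ i)
    (hlj : l ≠ j) (a b e : ZMod 2) :
    8 * (Finset.univ.filter fun c : n → ZMod 2 => c ∈ C ∧ (c i = a ∧ c j = b) ∧ c l = e).card =
      (Finset.univ.filter fun c : n → ZMod 2 => c ∈ C).card := by
  obtain ⟨d, hd, hdi, hdj, hdl⟩ := hC i j l hli hlj
  have e1 := two_mul_card_filter_coord C (fun c => c i = a ∧ c j = b) hd (by simp [hdi, hdj]) hdl e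
  have e2 := four_mul_card_filter_pair h1 hC hij a b
  omega

-- The weight is summed coordinate by coordinate: `i` and `j` contribute a quarter of `|C|` or
-- nothing, and by strength three every other coordinate contributes an eighth.
open scoped Classical in
theorem sum_hammingNorm_pair {C : Submodule (ZMod 2) (n → ZMod 2)}
    (h1 : (1 : n → ZMod 2) ∈ C) (hC : Separates C) {i j : n} (hij : i ≠ j) (a b : ZMod 2) :
    (∑ c : n → ZMod 2 with c ∈ C ∧ c i = a ∧ c j = b, (hammingNorm c : ℚ)) =
      (Finset.univ.filter fun c : n → ZMod 2 => c ∈ C).card *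
        ((if a = 1 then 1 / 4 else 0) + (if b = 1 then 1 / 4 else 0) +
          ((Fintype.card n : ℚ) - 2) / 8) := by
  set A : ℚ := (((Finset.univ.filter fun c : n → ZMod 2 => c ∈ C).card : ℕ) : ℚ) with hA
  have hw : ∀ c : n → ZMod 2, (hammingNorm c : ℚ) = ∑ l, if c l = 1 then 1 else 0 := by
    intro c
    have hne : ∀ a : ZMod 2, a ≠ 0 ↔ a = 1 := by decide
    simp [hammingNorm, hne]
  simp_rw [hw]
  rw [Finset.sum_comm]
  have h4 := four_mul_card_filter_pair h1 hC hij a b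
  have hl : ∀ l, (∑ c : n → ZMod 2 with c ∈ C ∧ c i = a ∧ c j = b,
      if c l = 1 then (1 : ℚ) else 0) = A / 8 +
        (if l = i then (if a = 1 then A / 4 else 0) - A / 8 else 0) +
        (if l = j then (if b = 1 then A / 4 else 0) - A / 8 else 0) := by
    intro l
    have h4' : ((Finset.univ.filter fun c : n → ZMod 2 => c ∈ C ∧ c i = a ∧ c j = b).card : ℚ) =
        A / 4 := by
      rw [hA, ← h4]; push_cast; ring
    by_cases hli : l = i
    · subst hli
      rw [if_pos rfl, if_neg hij]
      by_cases ha : a = 1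
      · rw [if_pos ha, Finset.sum_congr rfl (g := fun _ => (1 : ℚ))]
        · rw [Finset.sum_const, nsmul_one, h4']; ring
        · intro c hc
          rw [if_pos ((Finset.mem_filter.1 hc).2.2.1.trans ha)]
      · rw [if_neg ha, Finset.sum_eq_zero]
        · ring
        · intro c hc
          rw [if_neg]
          rw [(Finset.mem_filter.1 hc).2.2.1]; exact ha
    · rw [if_neg hli]
      by_cases hlj : l = j
      · subst hlj
        rw [if_pos rfl]
        by_cases hb : b = 1
        · rw [if_pos hb, Finset.sum_congr rfl (g := fun _ => (1 : ℚ))]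
          · rw [Finset.sum_const, nsmul_one, h4']; ring
          · intro c hc
            rw [if_pos ((Finset.mem_filter.1 hc).2.2.2.trans hb)]
        · rw [if_neg hb, Finset.sum_eq_zero]
          · ring
          · intro c hc
            rw [if_neg]
            rw [(Finset.mem_filter.1 hc).2.2.2]; exact hb
      · rw [if_neg hlj, Finset.sum_boole, Finset.filter_filter]
        have h8 := eight_mul_card_filter_triple h1 hC hij hli hlj a b 1
        simp only [and_assoc] at h8 ⊢
        rw [hA, ← h8]; push_cast; ring
  simp_rw [hl]
  simp only [Finset.sum_add_distrib, Finset.sum_ite_eq', Finset.mem_univ, if_true,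
    Finset.sum_const, Finset.card_univ, nsmul_eq_mul]
  split_ifs <;> ring

theorem pairCount_eq_pairCount {C : Submodule (ZMod 2) (n → ZMod 2)}
    (h1 : (1 : n → ZMod 2) ∈ C) (hC : Separates C) {w₁ w₂ : ℕ} (hw : w₁ ≠ w₂)
    (hwt : ∀ c ∈ C, c = 0 ∨ c = 1 ∨ hammingNorm c = w₁ ∨ hammingNorm c = w₂) (w : ℕ)
    (a b : ZMod 2) {i j i' j' : n} (hij : i ≠ j) (hij' : i' ≠ j') :
    pairCount C w a b i j = pairCount C w a b i' j' := by
  classical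
  have hw' : (w₁ : ℚ) - w₂ ≠ 0 := sub_ne_zero.2 (by exact_mod_cast hw)
  -- The line `α + β x` interpolates the indicator `v` at `w₁` and `w₂`, so the error `ψ` lives only
  -- on the words `0` and `1`.
  let v : ℕ → ℚ := fun x => if x = w then 1 else 0
  let β : ℚ := (v w₁ - v w₂) / (w₁ - w₂)
  let α : ℚ := v w₁ - β * w₁
  let ψ : (n → ZMod 2) → ℚ := fun c => v (hammingNorm c) - α - β * hammingNorm c
  have hψ : ∀ c ∈ C, c ≠ 0 → c ≠ 1 → ψ c = 0 := by
    intro c hc h0 h1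
    rcases hwt c hc with h | h | h | h
    · exact absurd h h0
    · exact absurd h h1
    · simp only [ψ, h, α]; ring
    · simp only [ψ, h, α, β]; field_simp; ring
  have key : ∀ i j : n, i ≠ j → (pairCount C w a b i j : ℚ) =
      ((if a = 0 ∧ b = 0 then ψ 0 else 0) + (if a = 1 ∧ b = 1 then ψ 1 else 0)) +
      α * ((Finset.univ.filter fun c : n → ZMod 2 => c ∈ C).card / 4) +
      β * ((Finset.univ.filter fun c : n → ZMod 2 => c ∈ C).card *
        ((if a = 1 then 1 / 4 else 0) + (if b = 1 then 1 / 4 else 0) +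
          ((Fintype.card n : ℚ) - 2) / 8)) := by
    intro i j hij
    rw [← sum_hammingNorm_pair h1 hC hij a b, ← four_mul_card_filter_pair h1 hC hij a b]
    have hcount : (pairCount C w a b i j : ℚ) =
        ∑ c : n → ZMod 2 with c ∈ C ∧ c i = a ∧ c j = b, v (hammingNorm c) := by
      rw [Finset.sum_boole, Finset.filter_filter, pairCount]
      congr 2
      ext c
      simp only [Finset.mem_filter, Finset.mem_univ, true_and]
      tauto
    have hsum : ∑ c : n → ZMod 2 with c ∈ C ∧ c i = a ∧ c j = b, ψ c =
        (if a = 0 ∧ b = 0 then ψ 0 else 0) + (if a = 1 ∧ b = 1 then ψ 1 else 0) := by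
      have h01 : (0 : n → ZMod 2) ≠ 1 := fun h => by simpa using congrFun h i
      rw [Finset.sum_filter, ← Finset.sum_subset (Finset.subset_univ {0, 1}),
        Finset.sum_pair h01]
      · simp [C.zero_mem, h1, eq_comm]
      · intro c _ hc
        simp only [Finset.mem_insert, Finset.mem_singleton, not_or] at hc
        split_ifs with h
        · exact hψ c h.1 hc.1 hc.2
        · rfl
    rw [hcount, ← hsum]
    simp only [ψ, Finset.sum_sub_distrib, Finset.mul_sum, Finset.sum_const, nsmul_eq_mul]
    push_cast
    ring
  have := (key i j hij).trans (key i' j' hij').symm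
  exact_mod_cast this

/-! ### Character sums and the dual code. -/

/-- The nontrivial character of the field with two elements. -/
def sign (a : ZMod 2) : ℤ := (-1) ^ a.val

@[simp] theorem sign_zero : sign 0 = 1 := rfl

@[simp] theorem sign_one : sign 1 = -1 := rfl

theorem sign_add (a b : ZMod 2) : sign (a + b) = sign a * sign b := by
  revert a b; decide

open scoped Classical in
theorem sum_sign_dotProduct (C : Submodule (ZMod 2) (n → ZMod 2)) (x : n → ZMod 2) :
    ∑ c : n → ZMod 2 with c ∈ C, sign (x ⬝ᵥ c) =
      if x ∈ dualCode C then ((Finset.univ.filter fun c : n → ZMod 2 => c ∈ C).card : ℤ) else 0 := by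
  split_ifs with h
  · rw [Finset.sum_congr rfl (g := fun _ => (1 : ℤ))]
    · simp
    · intro c hc
      rw [h c (Finset.mem_filter.1 hc).2, sign_zero]
  · have : ∃ d ∈ C, x ⬝ᵥ d ≠ 0 := by
      by_contra! h'
      exact h h'
    obtain ⟨d, hd, hxd⟩ := this
    have hxd1 := (zmod_two_cases _).resolve_left hxd
    have := Finset.sum_equiv (s := Finset.univ.filter fun c : n → ZMod 2 => c ∈ C)
      (t := Finset.univ.filter fun c : n → ZMod 2 => c ∈ C) (Equiv.addRight d)
      (f := fun c => - sign (x ⬝ᵥ c)) (g := fun c => sign (x ⬝ᵥ c))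
      (by intro c; simp [Submodule.add_mem_iff_left C hd])
      (by intro c _; simp [dotProduct_add, sign_add, hxd1])
    rw [Finset.sum_neg_distrib] at this
    omega

open scoped Classical in
theorem card_filter_ne_pair (c : n → ZMod 2) {i j : n} (hij : i ≠ j) (v : ZMod 2) :
    (Finset.univ.filter fun l => c l = v ∧ l ≠ i ∧ l ≠ j).card + (if c i = v then 1 else 0) +
      (if c j = v then 1 else 0) = (Finset.univ.filter fun l => c l = v).card := by
  simp only [Finset.card_filter]
  have h : ∀ l, (if c l = v then 1 else 0) = (if c l = v ∧ l ≠ i ∧ l ≠ j then 1 else 0) +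
      (if l = i then (if c i = v then 1 else 0) else 0) +
      (if l = j then (if c j = v then 1 else 0) else 0) := by
    intro l
    by_cases hi : l = i
    · subst hi; simp [hij]
    · by_cases hj : l = j
      · subst hj; simp [hi]
      · simp [hi, hj]
  rw [Finset.sum_congr rfl fun l _ => h l]
  simp [Finset.sum_add_distrib]

theorem card_filter_eq_of_hammingNorm_eq {c c' : n → ZMod 2} (h : hammingNorm c = hammingNorm c')
    (v : ZMod 2) : (Finset.univ.filter fun l => c l = v).card =
      (Finset.univ.filter fun l => c' l = v).card := by
  have hne : ∀ a : ZMod 2, a ≠ 0 ↔ a = 1 := by decide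
  have h1 : (Finset.univ.filter fun l => c l = 1).card =
      (Finset.univ.filter fun l => c' l = 1).card := by
    simpa only [hammingNorm, hne] using h
  rcases zmod_two_cases v with rfl | rfl
  · have e := Finset.card_filter_add_card_filter_not (s := Finset.univ) (fun l => c l = 0)
    have e' := Finset.card_filter_add_card_filter_not (s := Finset.univ) (fun l => c' l = 0)
    have hne : ∀ a : ZMod 2, ¬ a = 0 ↔ a = 1 := by decide
    simp only [hne] at e e'
    omega
  · exact h1

theorem exists_perm_of_hammingNorm_eq {c c' : n → ZMod 2} (h : hammingNorm c = hammingNorm c')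
    {i j i' j' : n} (hij : i ≠ j) (hij' : i' ≠ j') (hi : c i = c' i') (hj : c j = c' j') :
    ∃ σ : Equiv.Perm n, σ i = i' ∧ σ j = j' ∧ ∀ l, c' (σ l) = c l := by
  classical
  -- A bijection matching fibres of `f` and `g` carries `c` to `c'` and the marked points to the
  -- marked points.
  let f : n → ZMod 2 × Bool × Bool := fun l => (c l, decide (l = i), decide (l = j))
  let g : n → ZMod 2 × Bool × Bool := fun l => (c' l, decide (l = i'), decide (l = j'))
  have hfg : ∀ t, Nonempty ({l // f l = t} ≃ {l // g l = t}) := by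
    rintro ⟨v, p, q⟩
    refine ⟨Fintype.equivOfCardEq ?_⟩
    rw [Fintype.card_subtype, Fintype.card_subtype]
    simp only [f, g, Prod.mk.injEq]
    have single : ∀ (d : n → ZMod 2) (k : n), (Finset.univ.filter fun l => d l = v ∧ l = k).card =
        if d k = v then 1 else 0 := by
      intro d k
      rw [Finset.card_filter, Finset.sum_eq_single k]
      · simp
      · intro l _ hl; simp [hl]
      · simp
    cases p <;> cases q <;> simp only [decide_eq_true_eq, decide_eq_false_iff_not]
    · have e := card_filter_ne_pair c hij v
      have e' := card_filter_ne_pair c' hij' v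
      rw [hi, hj, card_filter_eq_of_hammingNorm_eq h v, ← e'] at e
      simp only [ne_eq] at e
      omega
    · have : ∀ (k k' : n), k ≠ k' → ∀ l, (¬ l = k ∧ l = k') ↔ l = k' := by
        rintro k k' hk l
        exact ⟨fun h => h.2, fun h => ⟨fun h' => hk (h'.symm.trans h), h⟩⟩
      simp only [this i j hij, this i' j' hij', single, hj]
    · have : ∀ (k k' : n), k ≠ k' → ∀ l, (l = k ∧ ¬ l = k') ↔ l = k := by
        rintro k k' hk l
        exact ⟨fun h => h.1, fun h => ⟨h, fun h' => hk (h.symm.trans h')⟩⟩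
      simp only [this i j hij, this i' j' hij', single, hi]
    · have : ∀ (k k' : n), k ≠ k' → ∀ l, (l = k ∧ l = k') ↔ False := by
        rintro k k' hk l
        exact ⟨fun h => hk (h.1.symm.trans h.2), False.elim⟩
      simp only [this i j hij, this i' j' hij', and_false]
  let σ := Equiv.ofFiberEquiv fun t => (hfg t).some
  have hσ : ∀ l, g (σ l) = f l := Equiv.ofFiberEquiv_map _
  have hσ' : ∀ l, c' (σ l) = c l ∧ (σ l = i' ↔ l = i) ∧ (σ l = j' ↔ l = j) := by
    intro l
    simpa [f, g] using hσ l
  exact ⟨σ, (hσ' i).2.1.2 rfl, (hσ' j).2.2.2 rfl, fun l => (hσ' l).1⟩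

theorem hammingNorm_comp_perm (σ : Equiv.Perm n) (x : n → ZMod 2) :
    hammingNorm (x ∘ σ) = hammingNorm x :=
  Finset.card_equiv σ (by simp)

open scoped Classical in
/-- The sum of the values of the character attached to `c` at the words of weight `k` whose support
contains `i` and `j`. -/
noncomputable def pairSum (k : ℕ) (c : n → ZMod 2) (i j : n) : ℤ :=
  ∑ x : n → ZMod 2 with hammingNorm x = k ∧ x i = 1 ∧ x j = 1, sign (x ⬝ᵥ c)

/-- Permuting coordinates preserves the weight and the inner product, so only the weight of `c` and
its values at the two marked coordinates matter. -/
theorem pairSum_eq_pairSum (k : ℕ) {c c' : n → ZMod 2} (h : hammingNorm c = hammingNorm c')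
    {i j i' j' : n} (hij : i ≠ j) (hij' : i' ≠ j') (hi : c i = c' i') (hj : c j = c' j') :
    pairSum k c i j = pairSum k c' i' j' := by
  classical
  obtain ⟨σ, hσi, hσj, hσ⟩ := exists_perm_of_hammingNorm_eq h hij hij' hi hj
  symm
  refine Finset.sum_equiv (σ.symm.arrowCongr (Equiv.refl _)) ?_ ?_
  · intro x
    have hx : (σ.symm.arrowCongr (Equiv.refl (ZMod 2))) x = x ∘ σ := rfl
    simp [hx, hammingNorm_comp_perm, hσi, hσj]
  · intro x _
    have hx : (σ.symm.arrowCongr (Equiv.refl (ZMod 2))) x = x ∘ σ := rfl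
    rw [hx]
    congr 1
    simp only [dotProduct, Function.comp]
    rw [← Equiv.sum_comp σ]
    simp only [hσ]

-- A MacWilliams identity with two marked coordinates: exchange the sums and apply orthogonality.
open scoped Classical in
theorem card_mul_pairCount_dualCode (C : Submodule (ZMod 2) (n → ZMod 2)) (k : ℕ) (i j : n) :
    ((Finset.univ.filter fun c : n → ZMod 2 => c ∈ C).card : ℤ) *
      pairCount (dualCode C) k 1 1 i j = ∑ c : n → ZMod 2 with c ∈ C, pairSum k c i j := by
  unfold pairSum
  rw [Finset.sum_comm]
  simp_rw [sum_sign_dotProduct]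
  rw [← Finset.sum_filter, Finset.filter_filter, Finset.sum_const, nsmul_eq_mul, mul_comm,
    pairCount]
  congr 3
  ext c
  simp only [Finset.mem_filter, Finset.mem_univ, true_and]
  tauto

theorem pairCount_dualCode_eq (C : Submodule (ZMod 2) (n → ZMod 2)) {i j i' j' : n} (hij : i ≠ j)
    (hij' : i' ≠ j')
    (h : ∀ w a b, pairCount C w a b i j = pairCount C w a b i' j') (k : ℕ) :
    pairCount (dualCode C) k 1 1 i j = pairCount (dualCode C) k 1 1 i' j' := by
  classical
  have hpos : (0 : ℤ) < (Finset.univ.filter fun c : n → ZMod 2 => c ∈ C).card := by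
    exact_mod_cast Finset.card_pos.2 ⟨0, by simp⟩
  suffices hs : ∑ c : n → ZMod 2 with c ∈ C, pairSum k c i j =
      ∑ c : n → ZMod 2 with c ∈ C, pairSum k c i' j' by
    rw [← card_mul_pairCount_dualCode, ← card_mul_pairCount_dualCode] at hs
    exact_mod_cast mul_left_cancel₀ hpos.ne' hs
  -- Equal joint distributions yield a bijection of `C` with itself matching the data on which
  -- `pairSum` depends.
  let f : {c // c ∈ C} → ℕ × ZMod 2 × ZMod 2 := fun c => (hammingNorm c.1, c.1 i, c.1 j)
  let g : {c // c ∈ C} → ℕ × ZMod 2 × ZMod 2 := fun c => (hammingNorm c.1, c.1 i', c.1 j')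
  have hfg : ∀ t, Nonempty ({c // f c = t} ≃ {c // g c = t}) := by
    rintro ⟨w, a, b⟩
    refine ⟨Fintype.equivOfCardEq ?_⟩
    rw [Fintype.card_congr (Equiv.subtypeSubtypeEquivSubtypeInter (fun c => c ∈ C)
        (fun c => (hammingNorm c, c i, c j) = (w, a, b))),
      Fintype.card_congr (Equiv.subtypeSubtypeEquivSubtypeInter (fun c => c ∈ C)
        (fun c => (hammingNorm c, c i', c j') = (w, a, b))),
      Fintype.card_subtype, Fintype.card_subtype]
    simpa only [Prod.mk.injEq, pairCount] using h w a b
  let e := Equiv.ofFiberEquiv fun t => (hfg t).some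
  have he : ∀ c, g (e c) = f c := Equiv.ofFiberEquiv_map _
  rw [Finset.sum_subtype _ (p := fun c => c ∈ C) (by simp),
    Finset.sum_subtype _ (p := fun c => c ∈ C) (by simp)]
  refine Fintype.sum_equiv e _ _ fun c => ?_
  have hc := he c
  simp only [f, g, Prod.mk.injEq] at hc
  exact pairSum_eq_pairSum k hc.1.symm hij hij' hc.2.1.symm hc.2.2.symm

/-- The two-weight case of the Assmus–Mattson theorem for binary codes containing the word `1`. -/
theorem holdsDesign_two_of_two_weights {C : Submodule (ZMod 2) (n → ZMod 2)}
    (h1 : (1 : n → ZMod 2) ∈ C) (hC : Separates C) {w₁ w₂ : ℕ} (hw : w₁ ≠ w₂)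
    (hwt : ∀ c ∈ C, c = 0 ∨ c = 1 ∨ hammingNorm c = w₁ ∨ hammingNorm c = w₂) {k : ℕ} (hk : 2 ≤ k) :
    ((∃ c ∈ C, hammingNorm c = k) → HoldsDesign C 2 k) ∧
      ((∃ c ∈ dualCode C, hammingNorm c = k) → HoldsDesign (dualCode C) 2 k) := by
  refine ⟨fun h => holdsDesign_two_of_pairCount C k hk h fun i j i' j' hij hij' =>
      pairCount_eq_pairCount h1 hC hw hwt k 1 1 hij hij',
    fun h => holdsDesign_two_of_pairCount _ k hk h fun i j i' j' hij hij' =>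
      pairCount_dualCode_eq C hij hij' (fun w a b =>
        pairCount_eq_pairCount h1 hC hw hwt w a b hij hij') k⟩

end Code

end BentDesign

namespace BentDesign

/-! ### The punctured subfield code as a space of affine functions. -/

section Affine

variable {K : Type*} [Field K] [Algebra (ZMod 2) K]

/-- The affine functions on `K × K` over the field with two elements, restricted to the zero set
of `f(x) + g(y)`. -/
def affineRestrict (f g : K → ZMod 2) :
    ZMod 2 × Module.Dual (ZMod 2) K × Module.Dual (ZMod 2) K →ₗ[ZMod 2]
      (ZeroSet f g → ZMod 2) where
  toFun t := fun p => t.1 + t.2.1 p.1.1 + t.2.2 p.1.2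
  map_add' s t := by
    funext p
    simp only [Prod.fst_add, Prod.snd_add, LinearMap.add_apply, Pi.add_apply]
    ring
  map_smul' r t := by
    funext p
    simp only [Prod.smul_fst, Prod.smul_snd, LinearMap.smul_apply, Pi.smul_apply, smul_eq_mul,
      RingHom.id_apply]
    ring

theorem affineRestrict_apply (f g : K → ZMod 2) (a : ZMod 2) (φ ψ : Module.Dual (ZMod 2) K)
    (p : ZeroSet f g) : affineRestrict f g (a, φ, ψ) p = a + φ p.1.1 + ψ p.1.2 := rfl

theorem puncturedSubfieldCode_eq_range {ι : Type*} [Fintype ι] (β : Module.Basis ι (ZMod 2) K)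
    (f g : K → ZMod 2) :
    puncturedSubfieldCode β f g = LinearMap.range (affineRestrict f g) := by
  classical
  rw [puncturedSubfieldCode, puncture, subfieldCode, Submodule.map_span, ← Set.range_comp]
  set G : Fin 3 × ι → ZeroSet f g → ZMod 2 := (LinearMap.funLeft (ZMod 2) (ZMod 2) some) ∘
    fun r => fun j => β.repr (genMatrix f g r.1 j) r.2 with hG
  have h0 : ∀ i, G (0, i) = affineRestrict f g (β.repr 1 i, 0, 0) := by
    intro i; funext p
    simp [hG, affineRestrict_apply, LinearMap.funLeft_apply, genMatrix]
  have h1 : ∀ i, G (1, i) = affineRestrict f g (0, β.coord i, 0) := by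
    intro i; funext p
    simp [hG, affineRestrict_apply, LinearMap.funLeft_apply, genMatrix]
  have h2 : ∀ i, G (2, i) = affineRestrict f g (0, 0, β.coord i) := by
    intro i; funext p
    simp [hG, affineRestrict_apply, LinearMap.funLeft_apply, genMatrix]
  apply le_antisymm
  · rw [Submodule.span_le]
    rintro _ ⟨⟨r, i⟩, rfl⟩
    fin_cases r
    · exact ⟨_, (h0 i).symm⟩
    · exact ⟨_, (h1 i).symm⟩
    · exact ⟨_, (h2 i).symm⟩
  · rintro _ ⟨⟨a, φ, ψ⟩, rfl⟩
    have hmem : ∀ r, G r ∈ Submodule.span (ZMod 2) (Set.range G) :=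
      fun r => Submodule.subset_span ⟨r, rfl⟩
    have hdual : ∀ φ : Module.Dual (ZMod 2) K, φ = ∑ i, φ (β i) • β.coord i :=
      fun φ => (β.sum_dual_apply_smul_coord φ).symm
    have hsplit : affineRestrict f g (a, φ, ψ) = affineRestrict f g (a, 0, 0) +
        affineRestrict f g (0, φ, 0) + affineRestrict f g (0, 0, ψ) := by
      rw [← map_add, ← map_add]; simp
    rw [hsplit]
    refine add_mem (add_mem ?_ ?_) ?_
    -- The rows coming from the entry `1` are constant words; one of them is the all-one word
    -- because `1 ≠ 0` has a nonzero coordinate.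
    · obtain ⟨i, hi⟩ : ∃ i, β.repr 1 i ≠ 0 := by
        by_contra! h
        exact one_ne_zero (β.repr.map_eq_zero_iff.1 (Finsupp.ext h))
      have : affineRestrict f g (a, 0, 0) = a • G (0, i) := by
        rw [h0, (zmod_two_cases _).resolve_left hi, ← map_smul]; simp
      rw [this]
      exact Submodule.smul_mem _ _ (hmem _)
    · have : affineRestrict f g (0, φ, 0) = ∑ i, φ (β i) • G (1, i) := by
        simp_rw [h1, ← map_smul]
        rw [← map_sum]
        congr 1
        ext1
        · simp [Prod.fst_sum]
        · ext1
          · simp only [Prod.snd_sum, Prod.fst_sum, Prod.smul_snd, Prod.smul_fst]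
            exact hdual φ
          · simp [Prod.snd_sum]
      rw [this]
      exact Submodule.sum_mem _ fun i _ => Submodule.smul_mem _ _ (hmem _)
    · have : affineRestrict f g (0, 0, ψ) = ∑ i, ψ (β i) • G (2, i) := by
        simp_rw [h2, ← map_smul]
        rw [← map_sum]
        congr 1
        ext1
        · simp [Prod.fst_sum]
        · ext1
          · simp [Prod.snd_sum, Prod.fst_sum]
          · simp only [Prod.snd_sum, Prod.smul_snd]
            exact hdual ψ
      rw [this]
      exact Submodule.sum_mem _ fun i _ => Submodule.smul_mem _ _ (hmem _)

theorem one_mem_range_affineRestrict (f g : K → ZMod 2) :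
    (1 : ZeroSet f g → ZMod 2) ∈ LinearMap.range (affineRestrict f g) :=
  ⟨(1, 0, 0), by funext p; simp [affineRestrict_apply]⟩

theorem separates_range_affineRestrict (f g : K → ZMod 2) :
    Separates (LinearMap.range (affineRestrict f g)) := by
  intro p q r hrp hrq
  -- This span is just `{0, q - p}`, so a functional kills `q - p` but not `r - p`; the separating
  -- word is `s ↦ φ (s - p)`.
  have hnot : r.1 - p.1 ∉ Submodule.span (ZMod 2) {q.1 - p.1} := by
    rw [Submodule.mem_span_singleton]
    rintro ⟨t, ht⟩
    rcases zmod_two_cases t with rfl | rfl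
    · rw [zero_smul] at ht
      exact hrp (Subtype.ext (sub_eq_zero.1 ht.symm))
    · rw [one_smul] at ht
      exact hrq (Subtype.ext (sub_left_injective ht).symm)
  obtain ⟨φ, hφ, hmap⟩ := Submodule.exists_dual_map_eq_bot_of_notMem hnot inferInstance
  have hq : φ (q.1 - p.1) = 0 := by
    have : φ (q.1 - p.1) ∈ (Submodule.span (ZMod 2) {q.1 - p.1}).map φ :=
      Submodule.mem_map_of_mem (Submodule.mem_span_singleton_self _)
    rwa [hmap, Submodule.mem_bot] at this
  have hr := (zmod_two_cases _).resolve_left hφ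
  have hval : ∀ s : ZeroSet f g, affineRestrict f g
      (- φ p.1, φ ∘ₗ LinearMap.inl _ _ _, φ ∘ₗ LinearMap.inr _ _ _) s = φ (s.1 - p.1) := by
    intro s
    rw [affineRestrict_apply, LinearMap.comp_apply, LinearMap.comp_apply, add_assoc, ← map_add,
      LinearMap.inl_apply, LinearMap.inr_apply, Prod.mk_add_mk, zero_add, add_zero, map_sub]
    ring
  refine ⟨affineRestrict f g (- φ p.1, φ ∘ₗ LinearMap.inl _ _ _, φ ∘ₗ LinearMap.inr _ _ _),
    ⟨_, rfl⟩, ?_, ?_, ?_⟩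
  · rw [hval, sub_self, map_zero]
  · rw [hval, hq]
  · rw [hval, hr]

end Affine

/-! ### Exponential sums and weights. -/

section Weights

theorem sum_sign_eq {n : Type*} [Fintype n] (c : n → ZMod 2) :
    ∑ i, sign (c i) = (Fintype.card n : ℤ) - 2 * hammingNorm c := by
  have h : ∀ a : ZMod 2, sign a = 1 - 2 * if a ≠ 0 then 1 else 0 := by decide
  simp_rw [h]
  rw [Finset.sum_sub_distrib, ← Finset.mul_sum, Finset.sum_boole]
  simp [hammingNorm]

variable {K : Type*} [Field K] [Fintype K] [Algebra (ZMod 2) K]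

theorem sum_sign_dual_eq_zero {φ : Module.Dual (ZMod 2) K} (hφ : φ ≠ 0) :
    ∑ x, sign (φ x) = 0 := by
  obtain ⟨y, hy⟩ : ∃ y, φ y ≠ 0 := by
    by_contra! h
    exact hφ (LinearMap.ext h)
  have hy1 := (zmod_two_cases _).resolve_left hy
  have := Equiv.sum_comp (Equiv.addRight y) fun x => sign (φ x)
  simp only [Equiv.coe_addRight, map_add, hy1, sign_add, sign_one, mul_neg, mul_one,
    Finset.sum_neg_distrib] at this
  omega

/-- By nondegeneracy of the trace form; this lets the Walsh condition apply to every linear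
functional. -/
theorem exists_trace_eq (φ : Module.Dual (ZMod 2) K) :
    ∃ b : K, ∀ x, φ x = Algebra.trace (ZMod 2) K (b * x) := by
  have : Fact (Nat.Prime 2) := ⟨Nat.prime_two⟩
  have : Module.Finite (ZMod 2) K := Module.Finite.of_finite
  obtain ⟨b, hb⟩ := ((Algebra.traceForm (ZMod 2) K).toDual
    (traceForm_nondegenerate (ZMod 2) K)).surjective φ
  exact ⟨b, fun x => by rw [← hb]; rfl⟩

theorem two_mul_sum_sign_affineRestrict (f g : K → ZMod 2) (φ ψ : Module.Dual (ZMod 2) K) :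
    2 * ∑ p, sign (affineRestrict f g (0, φ, ψ) p) =
      (∑ x, sign (φ x)) * (∑ y, sign (ψ y)) +
        (∑ x, sign (f x + φ x)) * ∑ y, sign (g y + ψ y) := by
  have h : ∀ p : K × K, (2 * if f p.1 + g p.2 = 0 then sign (φ p.1 + ψ p.2) else 0) =
      sign (φ p.1) * sign (ψ p.2) + sign (f p.1 + φ p.1) * sign (g p.2 + ψ p.2) := by
    intro p
    generalize f p.1 = a, g p.2 = b, φ p.1 = c, ψ p.2 = d
    revert a b c d
    decide
  rw [Finset.sum_mul_sum, Finset.sum_mul_sum, ← Finset.sum_add_distrib]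
  simp_rw [← Finset.sum_add_distrib]
  rw [← Fintype.sum_prod_type' (f := fun x y => sign (φ x) * sign (ψ y) +
    sign (f x + φ x) * sign (g y + ψ y))]
  simp_rw [← h]
  rw [← Finset.mul_sum, ← Finset.sum_filter]
  have e := Finset.sum_subtype (F := inferInstanceAs (Fintype (ZeroSet f g)))
    (p := fun p : K × K => f p.1 + g p.2 = 0)
    (Finset.univ.filter fun p : K × K => f p.1 + g p.2 = 0) (by simp)
    fun p => sign (φ p.1 + ψ p.2)
  rw [e]
  simp only [affineRestrict_apply, zero_add]

theorem IsBent.walsh_eq {m h : ℕ} (hm : m = h + h) {B : K → ZMod 2} (hB : IsBent m B) (b : K) :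
    walsh B b = 2 ^ h ∨ walsh B b = -2 ^ h := by
  have e : (2 : ℝ) ^ ((m : ℝ) / 2) = ((2 ^ h : ℤ) : ℝ) := by
    rw [hm]
    push_cast
    rw [add_self_div_two, Real.rpow_natCast]
  have := hB b
  rw [e] at this
  exact_mod_cast this

theorem IsBent.sum_sign_eq {m h : ℕ} (hm : m = h + h) {B : K → ZMod 2} (hB : IsBent m B)
    (φ : Module.Dual (ZMod 2) K) :
    ∑ x, sign (B x + φ x) = 2 ^ h ∨ ∑ x, sign (B x + φ x) = -2 ^ h := by
  obtain ⟨b, hb⟩ := exists_trace_eq φ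
  simp_rw [hb]
  exact hB.walsh_eq hm b

end Weights

end BentDesign

/-! ### The main theorem. -/

open BentDesign in
theorem theorem17 {K : Type*} [Field K] [Fintype K] [Algebra (ZMod 2) K] (m : ℕ) (hm : Even m)
    (hK : Fintype.card K = 2 ^ m) (β : Module.Basis (Fin m) (ZMod 2) K)
    (B₁ B₂ : K → ZMod 2) (hB₁ : BentDesign.IsBent m B₁) (hB₂ : BentDesign.IsBent m B₂)
    (hne : B₁ ≠ B₂) (W : ℤ) (hW : W = BentDesign.walsh B₁ 0 * BentDesign.walsh B₂ 0) :
    (W = 2 ^ m ∨ W = -2 ^ m) ∧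
    (∃ k₁ k₂ : ℕ,
      (k₁ : ℚ) = 2 ^ (2 * m - 2) + (W : ℚ) / 4 - 2 ^ (m - 2) ∧
      (k₂ : ℚ) = 2 ^ (2 * m - 2) + (W : ℚ) / 4 + 2 ^ (m - 2) ∧
      BentDesign.HoldsDesign (BentDesign.puncturedSubfieldCode β B₁ B₂) 2 k₁ ∧
      BentDesign.HoldsDesign (BentDesign.puncturedSubfieldCode β B₁ B₂) 2 k₂) ∧
    (∀ k : ℕ, 4 ≤ k → (k : ℚ) ≤ 2 ^ (2 * m - 1) + (W : ℚ) / 2 →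
      (∃ c ∈ BentDesign.dualCode (BentDesign.puncturedSubfieldCode β B₁ B₂), hammingNorm c = k) →
      BentDesign.HoldsDesign
        (BentDesign.dualCode (BentDesign.puncturedSubfieldCode β B₁ B₂)) 2 k) := by
  obtain ⟨h, hmh⟩ := hm
  have hm0 : m ≠ 0 := by
    rintro rfl
    have := Fintype.one_lt_card (α := K)
    omega
  -- An even nonzero `m` is at least `2`, so the subtraction in `2 ^ (m - 2)` is not truncated; this
  -- power is `q`.
  obtain ⟨s, rfl⟩ : ∃ s, m = s + 2 := ⟨m - 2, by omega⟩
  set q : ℤ := 2 ^ s with hq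
  have hq1 : 1 ≤ q := one_le_pow₀ (by norm_num)
  have hsq : (2 : ℤ) ^ h * 2 ^ h = 4 * q := by rw [← pow_add, ← hmh, pow_add, hq]; ring
  have hprod : ∀ u v : ℤ, (u = 2 ^ h ∨ u = -2 ^ h) → (v = 2 ^ h ∨ v = -2 ^ h) →
      u * v = 4 * q ∨ u * v = -(4 * q) := by
    rintro u v (rfl | rfl) (rfl | rfl) <;> simp [hsq]
  have hW4 : W = 4 * q ∨ W = -(4 * q) := by
    rw [hW]
    exact hprod _ _ (hB₁.walsh_eq hmh 0) (hB₂.walsh_eq hmh 0)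
  set n : ℤ := (Fintype.card (ZeroSet B₁ B₂) : ℤ) with hn
  have hlen : 2 * n = 16 * q ^ 2 + W := by
    have e := two_mul_sum_sign_affineRestrict B₁ B₂ 0 0
    have e0 : affineRestrict B₁ B₂ (0, 0, 0) = 0 := map_zero _
    have hw : ∀ B : K → ZMod 2, ∑ x, sign (B x) = walsh B 0 := by
      intro B; simp [walsh, sign]
    simp only [e0, Pi.zero_apply, sign_zero, Finset.sum_const, Finset.card_univ,
      LinearMap.zero_apply, add_zero, hw, ← hW, hK, nsmul_eq_mul, mul_one] at e
    rw [hn, e, hq]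
    push_cast
    ring
  have hwt : ∀ a φ ψ, (φ, ψ) ≠ 0 → n - 2 * hammingNorm (affineRestrict B₁ B₂ (a, φ, ψ)) = 2 * q ∨
      n - 2 * hammingNorm (affineRestrict B₁ B₂ (a, φ, ψ)) = -(2 * q) := by
    intro a φ ψ hφψ
    have e := two_mul_sum_sign_affineRestrict B₁ B₂ φ ψ
    have hz : (∑ x, sign (φ x)) * (∑ y, sign (ψ y)) = 0 := by
      by_cases hφ : φ = 0
      · have hψ : ψ ≠ 0 := fun hψ => hφψ (by rw [hφ, hψ]; rfl)
        rw [sum_sign_dual_eq_zero hψ, mul_zero]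
      · rw [sum_sign_dual_eq_zero hφ, zero_mul]
    rw [hz, zero_add] at e
    have hp := hprod _ _ (hB₁.sum_sign_eq hmh φ) (hB₂.sum_sign_eq hmh ψ)
    rw [← e] at hp
    rw [← sum_sign_eq]
    have ha : ∑ p, sign (affineRestrict B₁ B₂ (a, φ, ψ) p) =
        sign a * ∑ p, sign (affineRestrict B₁ B₂ (0, φ, ψ) p) := by
      rw [Finset.mul_sum]
      refine Finset.sum_congr rfl fun p _ => ?_
      simp only [affineRestrict_apply, zero_add, sign_add, mul_assoc]
    rw [ha]
    rcases zmod_two_cases a with rfl | rfl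
    · rw [sign_zero]; omega
    · rw [sign_one]; omega
  obtain ⟨k₁, hk₁⟩ : ∃ k : ℕ, (k : ℤ) = (n - 2 * q) / 2 :=
    ⟨((n - 2 * q) / 2).toNat, Int.toNat_of_nonneg (by
      apply Int.ediv_nonneg _ (by norm_num)
      rcases hW4 with h | h <;> nlinarith)⟩
  obtain ⟨k₂, hk₂⟩ : ∃ k : ℕ, (k : ℤ) = (n + 2 * q) / 2 :=
    ⟨((n + 2 * q) / 2).toNat, Int.toNat_of_nonneg (by
      apply Int.ediv_nonneg _ (by norm_num)
      rcases hW4 with h | h <;> nlinarith)⟩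
  -- Now `n = 8 q ^ 2 + 2 N` is even, so the integer divisions defining `k₁` and `k₂` are exact.
  obtain ⟨N, hN⟩ : ∃ N, W = 4 * N := by
    rcases hW4 with h | h
    · exact ⟨q, h⟩
    · exact ⟨-q, by rw [h]; ring⟩
  have hk₁' : (k₁ : ℤ) = 4 * q ^ 2 + N - q := by omega
  have hk₂' : (k₂ : ℤ) = 4 * q ^ 2 + N + q := by omega
  have h2k₁ : 2 ≤ k₁ := by
    have : (2 : ℤ) ≤ k₁ := by
      rw [hk₁']
      have : -q ≤ N := by omega
      nlinarith
    exact_mod_cast this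
  have hk₁₂ : k₁ < k₂ := by omega
  rw [puncturedSubfieldCode_eq_range]
  set C := LinearMap.range (affineRestrict B₁ B₂) with hC
  have hweights : ∀ c ∈ C, c = 0 ∨ c = 1 ∨ hammingNorm c = k₁ ∨ hammingNorm c = k₂ := by
    rintro _ ⟨⟨a, φ, ψ⟩, rfl⟩
    by_cases hφψ : (φ, ψ) = 0
    · rw [hφψ]
      rcases zmod_two_cases a with rfl | rfl
      · left; exact map_zero _
      · right; left; funext p; simp [affineRestrict]
    · right; right
      have := hwt a φ ψ hφψ
      omega
  have hdesign := fun {k} => holdsDesign_two_of_two_weights (one_mem_range_affineRestrict B₁ B₂)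
    (separates_range_affineRestrict B₁ B₂) hk₁₂.ne hweights (k := k)
  -- A nonconstant affine word and its complement have opposite character sums, hence realise one
  -- weight each.
  have hex : (∃ c ∈ C, hammingNorm c = k₁) ∧ ∃ c ∈ C, hammingNorm c = k₂ := by
    let φ := β.coord ⟨0, by omega⟩
    have hφ : φ ≠ 0 := fun h0 => by
      have := LinearMap.congr_fun h0 (β ⟨0, by omega⟩)
      simp [φ] at this
    have hφψ : (φ, (0 : Module.Dual (ZMod 2) K)) ≠ 0 := fun h0 => hφ (congrArg Prod.fst h0)
    set c₀ := affineRestrict B₁ B₂ (0, φ, 0) with hc₀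
    set c₁ := affineRestrict B₁ B₂ (1, φ, 0) with hc₁
    have h0 := hwt 0 φ 0 hφψ
    have hsum : (n - 2 * hammingNorm c₀) + (n - 2 * hammingNorm c₁) = 0 := by
      rw [← sum_sign_eq, ← sum_sign_eq, ← Finset.sum_add_distrib]
      refine Finset.sum_eq_zero fun p _ => ?_
      simp [hc₀, hc₁, affineRestrict_apply, sign_add]
    have m₀ : c₀ ∈ C := ⟨_, rfl⟩
    have m₁ : c₁ ∈ C := ⟨_, rfl⟩
    rw [← hc₀] at h0
    rcases h0 with h0 | h0
    · exact ⟨⟨c₀, m₀, by omega⟩, c₁, m₁, by omega⟩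
    · exact ⟨⟨c₁, m₁, by omega⟩, c₀, m₀, by omega⟩
  refine ⟨?_, ⟨k₁, k₂, ?_, ?_, (hdesign h2k₁).1 hex.1, (hdesign (by omega)).1 hex.2⟩,
    fun k hk _ hkex => (hdesign (by omega)).2 hkex⟩
  · rw [pow_add, ← hq]
    norm_num
    omega
  · have : ((k₁ : ℤ) : ℚ) = ((4 * q ^ 2 + N - q : ℤ) : ℚ) := by rw [hk₁']
    have e : 2 * (s + 2) - 2 = s * 2 + 2 := by omega
    rw [hN, e, pow_add, pow_mul, Nat.add_sub_cancel]
    push_cast [hq] at this ⊢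
    rw [this]
    ring
  · have : ((k₂ : ℤ) : ℚ) = ((4 * q ^ 2 + N + q : ℤ) : ℚ) := by rw [hk₂']
    have e : 2 * (s + 2) - 2 = s * 2 + 2 := by omega
    rw [hN, e, pow_add, pow_mul, Nat.add_sub_cancel]
    push_cast [hq] at this ⊢
    rw [this]
    ring
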